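/- Let $n\geq 1$ and let $w=(w_1,\ldots,w_n)\in\mathbb{R}^n$ have all components nonzero. Let $C^n=[-\tfrac12,\tfrac12]^n$, let $H_{w,0}=\{x\in\mathbb{R}^n : w\cdot x=0\}$, let $\|w\|_2$ be the Euclidean norm of $w$, and let $V_n^-$ be the set of vectors $s\in\{-1,1\}^n$ whose last coordinate is $s_n=-1$. For $s\in\{-1,1\}^n$ put $\epsilon_s=\prod_{i=1}^n s_i$. For real $r$ and an integer $k\geq 0$ put $r_+^k=(\max\{r,0\})^k$, where in the case $k=0$ (which occurs only for $n=1$) $0^0$ is read as $0$, so that $r_+^0$ is $1$ if $r>0$ and $0$ if $r\leq 0$. Then the section $H_{w,0}\cap C^n$ has finite $(n-1)$-dimensional volume ($(n-1)$-dimensional Lebesgue measure on the hyperplane $H_{w,0}$; counting measure if $n=1$), given by \[ \mathrm{vol}_{n-1}\bigl(H_{w,0}\cap C^n\bigr)=\frac{\|w\|_2}{w_n}+\frac{\|w\|_2}{2^{n-2}\,(n-1)!\,\prod_{i=1}^n w_i}\sum_{s\in V_n^-}\epsilon_s\,(w\cdot s)_+^{\,n-1}. \] -/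

import Mathlib

open scoped MeasureTheory

namespace CubeSection

/-- The centered unit cube `[-1/2, 1/2]^n` in `ℝ^n`. -/
def cube (n : ℕ) : Set (EuclideanSpace ℝ (Fin n)) :=
  {x | ∀ i, x i ∈ Set.Icc (-(1 / 2) : ℝ) (1 / 2)}

/-- The hyperplane `{x : w · x = z}` in `ℝ^n`. -/
def hyperplane {n : ℕ} (w : EuclideanSpace ℝ (Fin n)) (z : ℝ) :
    Set (EuclideanSpace ℝ (Fin n)) :=
  {x | ∑ i, w i * x i = z}

/-- The sign vectors `{-1, 1}^n`. -/
noncomputable def signVectors (n : ℕ) : Finset (Fin n → ℝ) :=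
  Fintype.piFinset fun _ => {-1, 1}

/-- The index of the last coordinate of a vector in `ℝ^n`, for `n ≥ 1`. -/
def lastIndex (n : ℕ) (hn : 1 ≤ n) : Fin n := ⟨n - 1, by omega⟩

/-- The sign vectors whose last coordinate is `-1`. -/
noncomputable def negSignVectors (n : ℕ) (hn : 1 ≤ n) : Finset (Fin n → ℝ) :=
  (signVectors n).filter fun s => s (lastIndex n hn) = -1

/-- The sign `∏ i, s i` of a sign vector. -/
def sign {n : ℕ} (s : Fin n → ℝ) : ℝ := ∏ i, s i

/-- The truncated power `r₊^k`. For `k ≥ 1` it is `(max r 0) ^ k` (see `truncPow_eq`); for `k = 0`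
it is `1` when `r > 0` and `0` when `r ≤ 0`, that is, `(max r 0) ^ 0` with `0 ^ 0` read as `0`. -/
noncomputable def truncPow (r : ℝ) (k : ℕ) : ℝ := if 0 < r then r ^ k else 0

theorem truncPow_eq (r : ℝ) {k : ℕ} (hk : k ≠ 0) : truncPow r k = (max r 0) ^ k := by
  unfold truncPow
  split_ifs with h
  · rw [max_eq_left h.le]
  · rw [max_eq_right (not_lt.mp h), zero_pow hk]

end CubeSection

namespace CubeSection

open MeasureTheory Measure Set

/-! Since `w n ≠ 0`, the section is the graph of a linear functional over the first `m = n - 1`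
coordinates, with area factor `‖w‖ / |w n|`. The last coordinate lies in `[-1/2, 1/2]` exactly on a
slab of the `m`-cube, so the slab's volume remains to be found. Reflection in the origin makes this
volume `1 - 2 F (-|w n| / 2)`, with `F` the half-space volume, and also lets `w n` replace `|w n|`
in the quotient. Fubini and induction on dimension give `F` as a signed sum of truncated powers
(`halfspaceVolume_eq`). Evaluating it at `-w n / 2` amounts to fixing the last sign to `-1`. -/

/-! ### Half-spaces and hyperplanes in the cube -/

/-- Lebesgue measure on `ℝ^m`, restricted to the centered unit cube. -/
noncomputable def cubeMeasure (m : ℕ) : Measure (Fin m → ℝ) :=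
  Measure.pi fun _ => (volume : Measure ℝ).restrict (Icc (-(1 / 2)) (1 / 2))

instance isProbabilityMeasure_restrict_Icc_half :
    IsProbabilityMeasure ((volume : Measure ℝ).restrict (Icc (-(1 / 2)) (1 / 2))) :=
  ⟨by simp only [restrict_apply_univ, Real.volume_Icc]; norm_num⟩

instance isProbabilityMeasure_cubeMeasure (m : ℕ) : IsProbabilityMeasure (cubeMeasure m) := by
  unfold cubeMeasure; infer_instance

theorem cubeMeasure_apply {m : ℕ} {S : Set (Fin m → ℝ)} (hS : MeasurableSet S) :
    cubeMeasure m S = volume (S ∩ {y | ∀ i, y i ∈ Icc (-(1 / 2) : ℝ) (1 / 2)}) := by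
  have h : cubeMeasure m = (volume : Measure (Fin m → ℝ)).restrict
      (univ.pi fun _ => Icc (-(1 / 2) : ℝ) (1 / 2)) := by
    rw [cubeMeasure, volume_pi, restrict_pi_pi]
  rw [h, restrict_apply hS]
  congr 2
  ext y
  simp only [mem_pi, mem_univ, true_imp_iff, mem_ofPred_eq]

theorem measurableSet_halfspace {m : ℕ} (w : Fin m → ℝ) (t : ℝ) :
    MeasurableSet {y : Fin m → ℝ | ∑ i, w i * y i < t} :=
  measurableSet_lt (by fun_prop) measurable_const

/-- The volume of the part of the cube in an open half-space. -/
noncomputable def halfspaceVolume {m : ℕ} (w : Fin m → ℝ) (t : ℝ) : ℝ :=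
  (cubeMeasure m).real {y | ∑ i, w i * y i < t}

theorem cubeMeasure_succ_apply {m : ℕ} {S : Set (Fin (m + 1) → ℝ)} (hS : MeasurableSet S) :
    cubeMeasure (m + 1) S =
      (((volume : Measure ℝ).restrict (Icc (-(1 / 2)) (1 / 2))).prod (cubeMeasure m))
        {p | Fin.cons p.1 p.2 ∈ S} := by
  have h := (measurePreserving_piFinSuccAbove (n := m)
    (fun _ => (volume : Measure ℝ).restrict (Icc (-(1 / 2)) (1 / 2))) 0).symm
  rw [cubeMeasure, ← h.measure_preimage hS.nullMeasurableSet]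
  congr 1
  ext p
  simp [MeasurableEquiv.piFinSuccAbove, Fin.insertNthEquiv]

theorem halfspaceVolume_succ {m : ℕ} (w : Fin (m + 1) → ℝ) (t : ℝ) :
    halfspaceVolume w t =
      ∫ a in (-(1 / 2) : ℝ)..(1 / 2), halfspaceVolume (fun i => w i.succ) (t - w 0 * a) := by
  have hS := measurableSet_halfspace w t
  have hT : MeasurableSet {p : ℝ × (Fin m → ℝ) | w 0 * p.1 + ∑ i, w (Fin.succ i) * p.2 i < t} :=
    measurableSet_lt (by fun_prop) measurable_const
  have hcut : ∀ a : ℝ, Prod.mk a ⁻¹'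
      {p : ℝ × (Fin m → ℝ) | w 0 * p.1 + ∑ i, w (Fin.succ i) * p.2 i < t} =
      {y | ∑ i, w (Fin.succ i) * y i < t - w 0 * a} := by
    intro a
    ext y
    simp only [mem_preimage, mem_ofPred_eq]
    constructor <;> intro h <;> linarith
  rw [intervalIntegral.integral_of_le (by norm_num), ← integral_Icc_eq_integral_Ioc,
    halfspaceVolume, measureReal_def, cubeMeasure_succ_apply hS]
  simp only [mem_ofPred_eq, Fin.sum_univ_succ, Fin.cons_zero, Fin.cons_succ]
  rw [prod_apply hT]
  simp only [hcut, halfspaceVolume, measureReal_def]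
  rw [integral_toReal]
  · have := measurable_measure_prodMk_left (ν := cubeMeasure m) hT
    simp only [hcut] at this
    exact this.aemeasurable
  · exact Filter.Eventually.of_forall fun a => measure_lt_top _ _

/-- A line parallel to the first axis meets the hyperplane at most once. In dimension zero the sum
is empty, so level `0` would carry full mass; hence `t ≠ 0`. -/
theorem cubeMeasure_hyperplane {m : ℕ} (w : Fin m → ℝ) (hw : ∀ i, w i ≠ 0) (t : ℝ)
    (ht : t ≠ 0) : cubeMeasure m {y | ∑ i, w i * y i = t} = 0 := by
  cases m with
  | zero => simp [ht.symm]
  | succ m =>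
    have hS : MeasurableSet {y : Fin (m + 1) → ℝ | ∑ i, w i * y i = t} :=
      measurableSet_eq_fun (by fun_prop) measurable_const
    have hT : MeasurableSet
        {p : ℝ × (Fin m → ℝ) | w 0 * p.1 + ∑ i, w (Fin.succ i) * p.2 i = t} :=
      measurableSet_eq_fun (by fun_prop) measurable_const
    rw [cubeMeasure_succ_apply hS]
    simp only [mem_ofPred_eq, Fin.sum_univ_succ, Fin.cons_zero, Fin.cons_succ]
    rw [prod_apply_symm hT, lintegral_eq_zero_of_ae_eq_zero]
    refine Filter.Eventually.of_forall fun y => ?_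
    refine Set.Subsingleton.measure_zero (fun a ha b hb => ?_) _
    simp only [mem_preimage, mem_ofPred_eq] at ha hb
    exact mul_left_cancel₀ (hw 0) (by linarith)

/-! ### Integrals of truncated powers -/

theorem truncPow_succ (r : ℝ) (k : ℕ) : truncPow r (k + 1) = (max r 0) ^ (k + 1) :=
  truncPow_eq r k.succ_ne_zero

theorem monotone_truncPow (k : ℕ) : Monotone fun r => truncPow r k := by
  intro a b hab
  simp only [truncPow]
  split_ifs with ha hb
  · gcongr
  · exact absurd (ha.trans_le hab) hb
  · positivity
  · rfl

theorem integral_truncPow (k : ℕ) (a b : ℝ) :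
    ∫ x in a..b, truncPow x k = (truncPow b (k + 1) - truncPow a (k + 1)) / (k + 1) := by
  rw [sub_div]
  -- For `k = 0` the integrand jumps at `0`, but the primitive is still continuous there.
  refine integral_eq_of_hasDerivAt_off_countable (fun x => truncPow x (k + 1) / (k + 1)) _
    (countable_singleton (0 : ℝ)) ?_ ?_ (monotone_truncPow k).intervalIntegrable
  · simp only [truncPow_succ]
    fun_prop
  · rintro x ⟨-, hx⟩
    have hk : (k + 1 : ℝ) ≠ 0 := by positivity
    rcases lt_or_gt_of_ne (show x ≠ 0 from hx) with h | h
    · refine ((hasDerivAt_const x (0 : ℝ)).congr_of_eventuallyEq ?_).congr_deriv ?_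
      · filter_upwards [Iio_mem_nhds h] with y hy
        simp [truncPow, not_lt.mpr (le_of_lt (show y < 0 from hy))]
      · simp [truncPow, not_lt.mpr h.le]
    · refine (((hasDerivAt_pow (k + 1) x).div_const (k + 1 : ℝ)).congr_of_eventuallyEq
        ?_).congr_deriv ?_
      · filter_upwards [Ioi_mem_nhds h] with y hy
        simp [truncPow, show 0 < y from hy]
      · simp only [truncPow, h, if_true, Nat.add_sub_cancel]
        push_cast
        field_simp

theorem integral_truncPow_sub_mul (k : ℕ) {c : ℝ} (hc : c ≠ 0) (t : ℝ) :
    ∫ x in (-(1 / 2) : ℝ)..(1 / 2), truncPow (t - c * x) k =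
      (truncPow (t + c / 2) (k + 1) - truncPow (t - c / 2) (k + 1)) / ((k + 1) * c) := by
  rw [intervalIntegral.integral_comp_sub_mul (fun x => truncPow x k) hc, integral_truncPow,
    smul_eq_mul, show t - c * -(1 / 2) = t + c / 2 by ring, show t - c * (1 / 2) = t - c / 2 by ring]
  have hk : (k + 1 : ℝ) ≠ 0 := by positivity
  field_simp

/-! ### The half-space volume as a signed sum -/

theorem mem_signVectors {n : ℕ} {s : Fin n → ℝ} :
    s ∈ signVectors n ↔ ∀ i, s i = -1 ∨ s i = 1 := by
  simp [signVectors]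

theorem sum_signVectors_succ {n : ℕ} (g : (Fin (n + 1) → ℝ) → ℝ) :
    ∑ s ∈ signVectors (n + 1), g s =
      ∑ s ∈ signVectors n, (g (Fin.cons 1 s) + g (Fin.cons (-1) s)) := by
  have h : ∑ s ∈ signVectors (n + 1), g s =
      ∑ p ∈ signVectors n ×ˢ ({1, -1} : Finset ℝ), g (Fin.cons p.2 p.1) := by
    refine Finset.sum_nbij' (fun s => (Fin.tail s, s 0)) (fun p => Fin.cons p.2 p.1) ?_ ?_ ?_ ?_ ?_
    · intro s hs
      rw [mem_signVectors] at hs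
      simp only [Finset.mem_product, mem_signVectors, Finset.mem_insert, Finset.mem_singleton]
      exact ⟨fun i => hs i.succ, (hs 0).symm⟩
    · rintro ⟨s, a⟩ hp
      simp only [Finset.mem_product, mem_signVectors, Finset.mem_insert,
        Finset.mem_singleton] at hp
      rw [mem_signVectors]
      exact Fin.cases hp.2.symm hp.1
    · intro s _
      simp
    · intro p _
      simp
    · intro s _
      simp
  rw [h, Finset.sum_product]
  refine Finset.sum_congr rfl fun s _ => ?_
  rw [Finset.sum_pair (by norm_num)]

/-- Integrating a term over the first coordinate gives a difference of values shifted by `± w 0 /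
2`: the two choices of a new sign, the minus being absorbed by `sign`. In dimension zero the strict
inequality matches the convention for `truncPow _ 0`. -/
theorem halfspaceVolume_eq {m : ℕ} (w : Fin m → ℝ) (hw : ∀ i, w i ≠ 0) (t : ℝ) :
    halfspaceVolume w t = (∑ s ∈ signVectors m, sign s * truncPow (t + (∑ i, w i * s i) / 2) m) /
      (m.factorial * ∏ i, w i) := by
  induction m generalizing t with
  | zero =>
    by_cases ht : 0 < t <;>
    simp [halfspaceVolume, signVectors, sign, truncPow, ht]
  | succ m ih =>
    rw [halfspaceVolume_succ]
    simp only [ih (fun i => w i.succ) (fun i => hw _)]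
    have hterm : ∀ s : Fin m → ℝ, IntervalIntegrable (fun a => sign s *
        truncPow (t - w 0 * a + (∑ i, w (Fin.succ i) * s i) / 2) m) volume (-(1 / 2)) (1 / 2) := by
      intro s
      refine IntervalIntegrable.const_mul ?_ _
      rcases le_total 0 (w 0) with h | h
      · refine Antitone.intervalIntegrable fun a b hab => monotone_truncPow m ?_
        gcongr
      · refine Monotone.intervalIntegrable fun a b hab => monotone_truncPow m ?_
        have := mul_le_mul_of_nonpos_left hab h
        linarith
    rw [intervalIntegral.integral_div, intervalIntegral.integral_finsetSum fun s _ => hterm s,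
      sum_signVectors_succ, Fin.prod_univ_succ, Nat.factorial_succ]
    have hstep : ∀ s : Fin m → ℝ, ∫ a in (-(1 / 2) : ℝ)..(1 / 2), sign s *
        truncPow (t - w 0 * a + (∑ i, w (Fin.succ i) * s i) / 2) m =
        (sign (Fin.cons 1 s : Fin (m + 1) → ℝ) * truncPow
            (t + (∑ i, w i * (Fin.cons 1 s : Fin (m + 1) → ℝ) i) / 2) (m + 1) +
          sign (Fin.cons (-1) s : Fin (m + 1) → ℝ) * truncPow
            (t + (∑ i, w i * (Fin.cons (-1) s : Fin (m + 1) → ℝ) i) / 2) (m + 1)) /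
          ((m + 1) * w 0) := by
      intro s
      simp only [sub_add_eq_add_sub]
      rw [intervalIntegral.integral_const_mul, integral_truncPow_sub_mul m (hw 0)]
      simp only [sign, Fin.prod_univ_succ, Fin.sum_univ_succ, Fin.cons_zero, Fin.cons_succ]
      rw [show ∀ b : ℝ, t + (w 0 * 1 + b) / 2 = t + b / 2 + w 0 / 2 from fun b => by ring,
        show ∀ b : ℝ, t + (w 0 * (-1) + b) / 2 = t + b / 2 - w 0 / 2 from fun b => by ring]
      ring
    simp only [hstep]
    rw [← Finset.sum_div, div_div]
    push_cast
    congr 1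
    ring


/-! ### The section as a graph -/

/-- The parametrization of the graph of the linear functional with coefficients `c`. -/
noncomputable def graphMap {m : ℕ} (c : Fin m → ℝ) :
    EuclideanSpace ℝ (Fin m) →ₗ[ℝ] EuclideanSpace ℝ (Fin (m + 1)) where
  toFun y := WithLp.toLp 2 (Fin.snoc (fun i => y i) (∑ i, c i * y i) : Fin (m + 1) → ℝ)
  map_add' x y := by
    ext i
    refine Fin.lastCases ?_ (fun j => ?_) i <;> simp [mul_add, Finset.sum_add_distrib]
  map_smul' a x := by
    ext i
    refine Fin.lastCases ?_ (fun j => ?_) i <;> simp [Finset.mul_sum, mul_left_comm]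

@[simp]
theorem graphMap_castSucc {m : ℕ} (c : Fin m → ℝ) (y : EuclideanSpace ℝ (Fin m)) (i : Fin m) :
    graphMap c y i.castSucc = y i := by
  simp [graphMap]

@[simp]
theorem graphMap_last {m : ℕ} (c : Fin m → ℝ) (y : EuclideanSpace ℝ (Fin m)) :
    graphMap c y (Fin.last m) = ∑ i, c i * y i := by
  simp [graphMap]

/-- The Gram matrix of the images of the standard basis is a rank-one perturbation of the identity,
so the matrix determinant lemma applies. -/
theorem normDet_graphMap_sq {m : ℕ} (c : Fin m → ℝ) :
    (graphMap c).normDet ^ 2 = 1 + ∑ i, c i ^ 2 := by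
  have h := (graphMap c).normDet_sq_eq_det_gram (EuclideanSpace.basisFun (Fin m) ℝ)
  have hgram : Matrix.gram ℝ (fun i => graphMap c (EuclideanSpace.basisFun (Fin m) ℝ i)) =
      1 + Matrix.replicateCol Unit c * Matrix.replicateRow Unit c := by
    ext i j
    rw [Matrix.gram_apply, PiLp.inner_apply, Fin.sum_univ_castSucc]
    simp [Matrix.mul_apply, Matrix.one_apply, PiLp.single_apply, mul_comm, eq_comm]
  rw [hgram, Matrix.det_one_add_replicateCol_mul_replicateRow] at h
  simpa [dotProduct, sq] using h

theorem normDet_graphMap_eq_norm_div {m : ℕ} (w : EuclideanSpace ℝ (Fin (m + 1)))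
    (hw : w (Fin.last m) ≠ 0) :
    (graphMap fun i : Fin m => -(w i.castSucc / w (Fin.last m))).normDet =
      ‖w‖ / |w (Fin.last m)| := by
  rw [← sq_eq_sq₀ (LinearMap.normDet_nonneg _) (by positivity), normDet_graphMap_sq, div_pow,
    EuclideanSpace.real_norm_sq_eq, sq_abs, Fin.sum_univ_castSucc, add_div, div_self (by positivity),
    Finset.sum_div, add_comm]
  simp only [neg_sq, div_pow]

theorem hyperplane_inter_cube {m : ℕ} (w : EuclideanSpace ℝ (Fin (m + 1)))
    (hw : w (Fin.last m) ≠ 0) :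
    hyperplane w 0 ∩ cube (m + 1) =
      graphMap (fun i : Fin m => -(w i.castSucc / w (Fin.last m))) ''
        (WithLp.ofLp ⁻¹' ({y : Fin m → ℝ | ∑ i, w i.castSucc * y i ∈
            Icc (-(|w (Fin.last m)| / 2)) (|w (Fin.last m)| / 2)} ∩
          {y | ∀ i, y i ∈ Icc (-(1 / 2) : ℝ) (1 / 2)})) := by
  have hsum : ∀ y : Fin m → ℝ, ∑ i, -(w i.castSucc / w (Fin.last m)) * y i =
      -(∑ i, w i.castSucc * y i) / w (Fin.last m) := by
    intro y
    rw [← Finset.sum_neg_distrib, Finset.sum_div]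
    exact Finset.sum_congr rfl fun i _ => by ring
  have habs : ∀ r : ℝ, r ∈ Icc (-(|w (Fin.last m)| / 2)) (|w (Fin.last m)| / 2) ↔
      -r / w (Fin.last m) ∈ Icc (-(1 / 2) : ℝ) (1 / 2) := by
    intro r
    rw [mem_Icc, mem_Icc, ← abs_le, ← abs_le, abs_div, abs_neg, div_le_iff₀ (abs_pos.mpr hw)]
    constructor <;> intro h <;> linarith
  ext x
  constructor
  · rintro ⟨hx, hc⟩
    have hx' : ∑ i : Fin m, w i.castSucc * x i.castSucc + w (Fin.last m) * x (Fin.last m) = 0 := by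
      rw [← Fin.sum_univ_castSucc (fun i => w i * x i)]
      exact hx
    have hlast : x (Fin.last m) =
        -(∑ i : Fin m, w i.castSucc * x i.castSucc) / w (Fin.last m) := by
      rw [eq_div_iff hw]
      linarith
    refine ⟨WithLp.toLp 2 fun i => x i.castSucc, ⟨?_, fun i => hc _⟩, ?_⟩
    · show _ ∈ Icc _ _
      rw [habs, ← hlast]
      exact hc _
    · ext i
      refine Fin.lastCases ?_ (fun j => ?_) i
      · rw [graphMap_last, hsum, hlast]
      · rw [graphMap_castSucc]
  · rintro ⟨y, ⟨hy, hc⟩, rfl⟩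
    constructor
    · show ∑ i, _ = _
      rw [Fin.sum_univ_castSucc, graphMap_last, hsum]
      simp only [graphMap_castSucc]
      field_simp
      ring
    · intro i
      refine Fin.lastCases ?_ (fun j => ?_) i
      · rw [graphMap_last, hsum, ← habs]
        exact hy
      · rw [graphMap_castSucc]
        exact hc j

theorem euclideanHausdorffMeasure_hyperplane_inter_cube {m : ℕ}
    (w : EuclideanSpace ℝ (Fin (m + 1))) (hw : w (Fin.last m) ≠ 0) :
    μHE[m] (hyperplane w 0 ∩ cube (m + 1)) = ENNReal.ofReal (‖w‖ / |w (Fin.last m)|) *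
      cubeMeasure m {y | ∑ i, w (Fin.castSucc i) * y i ∈
        Icc (-(|w (Fin.last m)| / 2)) (|w (Fin.last m)| / 2)} := by
  have hS : MeasurableSet {y : Fin m → ℝ | ∑ i, w i.castSucc * y i ∈
      Icc (-(|w (Fin.last m)| / 2)) (|w (Fin.last m)| / 2)} :=
    measurableSet_preimage (by fun_prop) measurableSet_Icc
  have hC : MeasurableSet {y : Fin m → ℝ | ∀ i, y i ∈ Icc (-(1 / 2) : ℝ) (1 / 2)} := by
    rw [ofPred_forall]
    exact MeasurableSet.iInter fun i =>
      measurableSet_preimage (measurable_pi_apply i) measurableSet_Icc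
  have h := (graphMap fun i : Fin m =>
    -(w i.castSucc / w (Fin.last m))).euclideanHausdorffMeasure_image_eq_normDet_mul_volume
      (WithLp.ofLp ⁻¹' ({y : Fin m → ℝ | ∑ i, w i.castSucc * y i ∈
            Icc (-(|w (Fin.last m)| / 2)) (|w (Fin.last m)| / 2)} ∩
          {y | ∀ i, y i ∈ Icc (-(1 / 2) : ℝ) (1 / 2)}))
  rw [finrank_euclideanSpace_fin, ← hyperplane_inter_cube w hw, normDet_graphMap_eq_norm_div w hw,
    (PiLp.volume_preserving_ofLp (Fin m)).measure_preimage (hS.inter hC).nullMeasurableSet,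
    ← cubeMeasure_apply hS] at h
  exact h

/-! ### Central symmetry and slabs -/

theorem measurePreserving_neg_cubeMeasure (m : ℕ) :
    MeasurePreserving (fun y : Fin m → ℝ => -y) (cubeMeasure m) (cubeMeasure m) := by
  refine measurePreserving_pi (fun _ => (volume : Measure ℝ).restrict (Icc (-(1 / 2)) (1 / 2)))
    (fun _ => (volume : Measure ℝ).restrict (Icc (-(1 / 2)) (1 / 2))) (f := fun _ a => -a)
    fun _ => ?_
  have h := (Measure.measurePreserving_neg (volume : Measure ℝ)).restrict_preimage
    (measurableSet_Icc (a := -(1 / 2 : ℝ)) (b := 1 / 2))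
  simpa using h

/-- Reflection carries `{< -t}` to `{> t}`, the complement of `{< t}` up to a null hyperplane. -/
theorem halfspaceVolume_neg_add {m : ℕ} (w : Fin m → ℝ) (hw : ∀ i, w i ≠ 0) {t : ℝ} (ht : t ≠ 0) :
    halfspaceVolume w (-t) + halfspaceVolume w t = 1 := by
  have hS := measurableSet_halfspace w t
  have hle : halfspaceVolume w t = (cubeMeasure m).real {y | ∑ i, w i * y i ≤ t} := by
    refine measureReal_congr ?_
    have h := measure_eq_zero_iff_ae_notMem.mp (cubeMeasure_hyperplane w hw t ht)
    filter_upwards [h] with y hy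
    exact propext ⟨fun h' => le_of_lt h', fun h' => lt_of_le_of_ne h' hy⟩
  have hneg : halfspaceVolume w (-t) = (cubeMeasure m).real {y | ∑ i, w i * y i ≤ t}ᶜ := by
    rw [halfspaceVolume, measureReal_def, ← (measurePreserving_neg_cubeMeasure m).measure_preimage
      (measurableSet_halfspace w (-t)).nullMeasurableSet, measureReal_def]
    congr 2
    ext y
    simp
  rw [hneg, hle, add_comm, measureReal_add_measureReal_compl]
  · exact probReal_univ
  · exact measurableSet_le (by fun_prop) measurable_const

theorem cubeMeasure_real_slab {m : ℕ} (w : Fin m → ℝ) (hw : ∀ i, w i ≠ 0) {a : ℝ} (ha : 0 < a) :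
    (cubeMeasure m).real {y | ∑ i, w i * y i ∈ Icc (-a) a} = 1 - 2 * halfspaceVolume w (-a) := by
  have h : (cubeMeasure m).real {y | ∑ i, w i * y i ∈ Icc (-a) a} =
      (cubeMeasure m).real ({y | ∑ i, w i * y i < a} \ {y | ∑ i, w i * y i < -a}) := by
    refine measureReal_congr ?_
    have h := measure_eq_zero_iff_ae_notMem.mp (cubeMeasure_hyperplane w hw a ha.ne')
    filter_upwards [h] with y hy
    refine propext ⟨fun h' => ⟨lt_of_le_of_ne h'.2 hy, not_lt.mpr h'.1⟩,
      fun h' => ⟨not_lt.mp h'.2, le_of_lt h'.1⟩⟩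
  rw [h, measureReal_sdiff _ (measurableSet_halfspace w (-a))]
  · have := halfspaceVolume_neg_add w hw ha.ne'
    simp only [halfspaceVolume] at this ⊢
    linarith
  · intro y hy
    have hy' : ∑ i, w i * y i < -a := hy
    exact hy'.trans (by linarith)

/-- By reflection `1 - 2 F (-a / 2)` is odd in `a ≠ 0`, so its quotient by `a` is even and the
absolute values can be dropped. -/
theorem cubeMeasure_real_slab_div {m : ℕ} (w : Fin m → ℝ) (hw : ∀ i, w i ≠ 0) {a : ℝ}
    (ha : a ≠ 0) :
    (cubeMeasure m).real {y | ∑ i, w i * y i ∈ Icc (-(|a| / 2)) (|a| / 2)} / |a| =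
      (1 - 2 * halfspaceVolume w (-a / 2)) / a := by
  rw [cubeMeasure_real_slab w hw (by positivity)]
  rcases abs_cases a with ⟨h, -⟩ | ⟨h, -⟩
  · rw [h, neg_div]
  · have := halfspaceVolume_neg_add w hw (t := a / 2) (by positivity)
    rw [h, show -(-a / 2) = a / 2 by ring, div_neg, ← neg_div, show -a / 2 = -(a / 2) by ring]
    congr 1
    linarith

theorem sum_negSignVectors_succ {m : ℕ} (hm : 1 ≤ m + 1) (g : (Fin (m + 1) → ℝ) → ℝ) :
    ∑ s ∈ negSignVectors (m + 1) hm, g s =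
      ∑ s ∈ signVectors m, g (Fin.snoc s (-1) : Fin (m + 1) → ℝ) := by
  have hlast : lastIndex (m + 1) hm = Fin.last m := rfl
  refine Finset.sum_nbij' (fun s => Fin.init s) (fun s => Fin.snoc s (-1)) ?_ ?_ ?_ ?_ ?_
  · intro s hs
    simp only [negSignVectors, Finset.mem_filter, mem_signVectors] at hs
    exact mem_signVectors.mpr fun i => hs.1 i.castSucc
  · intro s hs
    rw [mem_signVectors] at hs
    simp only [negSignVectors, Finset.mem_filter, mem_signVectors, hlast, Fin.snoc_last, and_true]
    refine fun i => Fin.lastCases ?_ (fun j => ?_) i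
    · simp
    · simpa using hs j
  · intro s hs
    simp only [negSignVectors, Finset.mem_filter, hlast] at hs
    rw [← hs.2, Fin.snoc_init_self]
  · intro s _
    simp
  · intro s hs
    simp only [negSignVectors, Finset.mem_filter, hlast] at hs
    rw [← hs.2, Fin.snoc_init_self]

end CubeSection

theorem mainTheorem6 (n : ℕ) (hn : 1 ≤ n) (w : EuclideanSpace ℝ (Fin n)) (hw : ∀ i, w i ≠ 0) :
    μHE[n - 1] (CubeSection.hyperplane w 0 ∩ CubeSection.cube n) < ⊤ ∧
    (μHE[n - 1]).real (CubeSection.hyperplane w 0 ∩ CubeSection.cube n) =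
      ‖w‖ / w (CubeSection.lastIndex n hn) +
        ‖w‖ / ((2 : ℝ) ^ ((n : ℤ) - 2) * ((n - 1).factorial : ℝ) * ∏ i, w i) *
          ∑ s ∈ CubeSection.negSignVectors n hn,
            CubeSection.sign s * CubeSection.truncPow (∑ i, w i * s i) (n - 1) := by
  obtain ⟨m, rfl⟩ : ∃ m, n = m + 1 := ⟨n - 1, by omega⟩
  have hlast : CubeSection.lastIndex (m + 1) hn = Fin.last m := rfl
  have hwl := hw (Fin.last m)
  have hprod : ∏ i : Fin m, w i.castSucc ≠ 0 := Finset.prod_ne_zero_iff.mpr fun i _ => hw _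
  have hmeas := CubeSection.euclideanHausdorffMeasure_hyperplane_inter_cube w hwl
  rw [Nat.add_sub_cancel, hlast]
  refine ⟨?_, ?_⟩
  · rw [hmeas]
    exact ENNReal.mul_lt_top ENNReal.ofReal_lt_top (MeasureTheory.measure_lt_top _ _)
  -- Homogeneity of degree `m`; the factor `2` is positive, so this also holds for `m = 0`.
  have hterm : ∀ s : Fin m → ℝ, CubeSection.truncPow
      (∑ i, w i * (Fin.snoc s (-1) : Fin (m + 1) → ℝ) i) m =
      2 ^ m * CubeSection.truncPow
        (-w (Fin.last m) / 2 + (∑ i, w (Fin.castSucc i) * s i) / 2) m := by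
    intro s
    simp only [Fin.sum_univ_castSucc, Fin.snoc_castSucc, Fin.snoc_last]
    set b := ∑ i : Fin m, w i.castSucc * s i
    have hb : b + w (Fin.last m) * -1 = 2 * (-w (Fin.last m) / 2 + b / 2) := by ring
    rw [hb, CubeSection.truncPow, CubeSection.truncPow]
    simp only [mul_pow, mul_ite, mul_zero, Nat.ofNat_pos, mul_pos_iff_of_pos_left]
  -- This minus sign accounts for the one in `1 - 2 F`.
  have hsign : ∀ s : Fin m → ℝ,
      CubeSection.sign (Fin.snoc s (-1) : Fin (m + 1) → ℝ) = -CubeSection.sign s := by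
    intro s
    simp [CubeSection.sign, Fin.prod_univ_castSucc]
  have hslab := CubeSection.cubeMeasure_real_slab_div (fun i : Fin m => w i.castSucc)
    (fun i => hw _) hwl
  rw [MeasureTheory.measureReal_def, hmeas, ENNReal.toReal_mul, ENNReal.toReal_ofReal (by positivity),
    ← MeasureTheory.measureReal_def, div_mul_eq_mul_div, mul_div_assoc, hslab,
    CubeSection.halfspaceVolume_eq _ fun i => hw _, CubeSection.sum_negSignVectors_succ,
    Fin.prod_univ_castSucc]
  simp only [hterm, hsign, neg_mul, mul_left_comm _ ((2 : ℝ) ^ m), Finset.sum_neg_distrib,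
    ← Finset.mul_sum]
  have hfact : (m.factorial : ℝ) ≠ 0 := by positivity
  -- The exponent is an integer because it equals `-1` when `n = 1`.
  have hpow : (2 : ℝ) ^ (((m + 1 : ℕ) : ℤ) - 2) = 2 ^ m / 2 := by
    rw [show (((m + 1 : ℕ) : ℤ) - 2) = (m : ℤ) - 1 by push_cast; ring,
      zpow_sub₀ two_ne_zero, zpow_natCast, zpow_one]
  rw [hpow]
  field_simp
  ring
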